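/- Let $\mathcal H$ be a separable infinite-dimensional complex Hilbert space, let $\mathcal K$ be a complex Hilbert space, let $g\ge 1$ and $d\ge 0$ be integers, let $\mathbb A_1,\dots,\mathbb A_g$ be bounded self-adjoint operators on $\mathcal K$, and let $L(x)=I+\sum_{j=1}^g \mathbb A_j x_j$ be the corresponding monic linear pencil in noncommuting variables $x_1,\dots,x_g$. Notation. For $n\ge 0$ let $\mathcal A_n$ be the space of polynomials $p=\sum_w P_w w$ with coefficients $P_w\in B(\mathcal H)$, where $w$ runs over the words of length at most $n$ in $x_1,\dots,x_g$. Such polynomials carry the involution $p^*=\sum_w P_w^* w^*$, where $w^*$ is the reversed word. The evaluation of $p$ at a $g$-tuple $X$ of bounded operators on a Hilbert space $\mathcal E$ is $p(X)=\sum_w P_w\otimes X^w$, acting on the Hilbert space tensor product $\mathcal H\otimes\mathcal E$; similarly $L(X)=I\otimes I+\sum_j \mathbb A_j\otimes X_j$ on $\mathcal K\otimes\mathcal E$. Let $\mathcal D_L$ be the collection of all $g$-tuples $X=(X_1,\dots,X_g)$ of self-adjoint complex matrices, of any common size, with $L(X)\succeq 0$; it is called bounded if there is $N\in\mathbb N$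 with $\|X_j\|\le N$ (operator norm) for all $X\in\mathcal D_L$ and all $j$. Let $\mathcal S_L\subset B(\mathcal K)$ be the linear span of $I,\mathbb A_1,\dots,\mathbb A_g$, and for a unital completely positive (ucp) map $\pi:\mathcal S_L\to B(\mathcal H)$ put $\pi(L)=\pi(I)+\sum_j\pi(\mathbb A_j)x_j$. Let $$\mathcal C_{d+1,d}=\{\, r^*r+q^*\pi(L)q \;:\; r\in\mathcal A_{d+1},\ q\in\mathcal A_d,\ \pi:\mathcal S_L\to B(\mathcal H)\text{ ucp}\,\}\subset\mathcal A_{2d+2}.$$ The product ultraweak topology on $\mathcal A_n$ is the one induced, through $p\mapsto (P_w)_{|w|\le n}$, by the product of the ultraweak topologies on the copies of $B(\mathcal H)$. Inner products are linear in the first variable. Theorem. Suppose that $\mathcal D_L$ is bounded, and let $\varphi:\mathcal A_{2d+2}\to\mathbb C$ be a linear functional that is continuous in the product ultraweak topology and satisfies $\varphi(p)\ge 0$ (that is, $\varphi(p)$ is real and nonnegative) for all $p\in\mathcal C_{d+1,d}$. Then there exist a separable Hilbert space $\mathcal E$, a $g$-tuple $Y=(Y_1,\dots,Y_g)$ of bounded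 self-adjoint operators on $\mathcal E$, and a vector $\gamma\in\mathcal H\otimes\mathcal E$ such that $L(Y)\succeq 0$ and $$\varphi(q^*r)=\langle r(Y)\gamma,\ q(Y)\gamma\rangle_{\mathcal H\otimes\mathcal E}\qquad\text{for all } r\in\mathcal A_{d+1},\ q\in\mathcal A_d.$$ Consequently, for all $p\in\mathcal A_{2d+1}$, $$\varphi(p)=\langle p(Y)\gamma,\ \gamma\rangle_{\mathcal H\otimes\mathcal E}.$$ -/

import Mathlib

open scoped ComplexOrder TensorProduct Topology

universe u v

noncomputable section

namespace NCGNS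

/-! ### Hilbert space tensor products -/

/-- The Hilbert space tensor product `H ⊗ E`: the completion of the algebraic tensor product for
the inner product `⟪a ⊗ b, c ⊗ d⟫ = ⟪a, c⟫ ⟪b, d⟫`. -/
abbrev HilbertTensor (H : Type u) (E : Type v)
    [NormedAddCommGroup H] [InnerProductSpace ℂ H]
    [NormedAddCommGroup E] [InnerProductSpace ℂ E] : Type (max u v) :=
  UniformSpace.Completion (H ⊗[ℂ] E)

/-- The bounded operator `P ⊗ T` on the Hilbert space tensor product. -/
def opTensor {H : Type u} {E : Type v}
    [NormedAddCommGroup H] [InnerProductSpace ℂ H]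
    [NormedAddCommGroup E] [InnerProductSpace ℂ E]
    (P : H →L[ℂ] H) (T : E →L[ℂ] E) : HilbertTensor H E →L[ℂ] HilbertTensor H E :=
  (TensorProduct.mapL P T).completion

theorem opTensor_coe_tmul {H : Type u} {E : Type v}
    [NormedAddCommGroup H] [InnerProductSpace ℂ H]
    [NormedAddCommGroup E] [InnerProductSpace ℂ E]
    (P : H →L[ℂ] H) (T : E →L[ℂ] E) (h : H) (e : E) :
    opTensor P T ((h ⊗ₜ[ℂ] e : H ⊗[ℂ] E) : HilbertTensor H E)
      = ((P h ⊗ₜ[ℂ] T e : H ⊗[ℂ] E) : HilbertTensor H E) := by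
  simp [opTensor]

/-! ### Operator-valued noncommutative polynomials -/

/-- `B(H)⟨x₁, …, x_g⟩`: finite formal sums `∑ P_w w` with `P_w ∈ B(H)` and `w` a word in `g`
letters, with the convolution product `(P u) (Q v) = (P Q) (u v)`. -/
abbrev NCPoly (H : Type u) [NormedAddCommGroup H] [InnerProductSpace ℂ H] (g : ℕ) : Type u :=
  MonoidAlgebra (H →L[ℂ] H) (FreeMonoid (Fin g))

/-- The polynomials of degree at most `n`. -/
def polyLE (H : Type u) [NormedAddCommGroup H] [InnerProductSpace ℂ H] (g n : ℕ) :
    Submodule ℂ (NCPoly H g) where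
  carrier := {p | ∀ w : FreeMonoid (Fin g), n < w.length → p.coeff w = 0}
  zero_mem' := by intro w _; simp
  add_mem' := by
    intro p q hp hq w hw
    simp [hp w hw, hq w hw]
  smul_mem' := by
    intro c p hp w hw
    simp [hp w hw]

/-- The involution `(∑ P_w w)^* = ∑ P_w^* w^*`, where `w^*` is the reversed word. -/
def adj {H : Type u} [NormedAddCommGroup H] [InnerProductSpace ℂ H] [CompleteSpace H] {g : ℕ}
    (p : NCPoly H g) : NCPoly H g :=
  p.coeff.sum fun w P => MonoidAlgebra.single (star w) (star P)

/-- The evaluation `p(X) = ∑ P_w ⊗ X^w` at a tuple of bounded operators. -/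
def eval {H : Type u} {E : Type v}
    [NormedAddCommGroup H] [InnerProductSpace ℂ H]
    [NormedAddCommGroup E] [InnerProductSpace ℂ E] {g : ℕ}
    (p : NCPoly H g) (X : Fin g → (E →L[ℂ] E)) : HilbertTensor H E →L[ℂ] HilbertTensor H E :=
  p.coeff.sum fun w P => opTensor P (FreeMonoid.lift X w)

/-! ### Degrees of products and adjoints -/

section Degree

variable {H : Type u} [NormedAddCommGroup H] [InnerProductSpace ℂ H] {g : ℕ}

theorem mem_polyLE {n : ℕ} {p : NCPoly H g} :
    p ∈ polyLE H g n ↔ ∀ w : FreeMonoid (Fin g), n < w.length → p.coeff w = 0 := Iff.rfl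

theorem polyLE_mono {m n : ℕ} (h : m ≤ n) : polyLE H g m ≤ polyLE H g n :=
  fun _ hp w hw => hp w (h.trans_lt hw)

theorem single_mem_polyLE {n : ℕ} {w : FreeMonoid (Fin g)} (hw : w.length ≤ n)
    (P : H →L[ℂ] H) : (MonoidAlgebra.single w P : NCPoly H g) ∈ polyLE H g n := by
  classical
  intro v hv
  rw [MonoidAlgebra.coeff_single, Finsupp.single_apply, if_neg]
  rintro rfl
  omega

theorem length_le_of_mem_support {n : ℕ} {p : NCPoly H g} (hp : p ∈ polyLE H g n)
    {w : FreeMonoid (Fin g)} (hw : w ∈ p.coeff.support) : w.length ≤ n := by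
  by_contra h
  exact (Finsupp.mem_support_iff.mp hw) (hp w (not_le.mp h))

theorem mul_mem_polyLE {m n : ℕ} {p q : NCPoly H g} (hp : p ∈ polyLE H g m)
    (hq : q ∈ polyLE H g n) : p * q ∈ polyLE H g (m + n) := by
  rw [MonoidAlgebra.mul_def]
  refine Submodule.sum_mem _ fun u hu => Submodule.sum_mem _ fun w hw => single_mem_polyLE ?_ _
  rw [FreeMonoid.length_mul]
  exact add_le_add (length_le_of_mem_support hp hu) (length_le_of_mem_support hq hw)

theorem adj_mem_polyLE [CompleteSpace H] {n : ℕ} {p : NCPoly H g} (hp : p ∈ polyLE H g n) :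
    adj p ∈ polyLE H g n := by
  refine Submodule.sum_mem _ fun w hw => single_mem_polyLE ?_ _
  have h : (star w).length = w.length := List.length_reverse
  rw [h]
  exact length_le_of_mem_support hp hw

theorem adj_mul_mem [CompleteSpace H] {d : ℕ} {q r : NCPoly H g}
    (hq : q ∈ polyLE H g d) (hr : r ∈ polyLE H g (d + 1)) :
    adj q * r ∈ polyLE H g (2 * d + 2) :=
  polyLE_mono (by omega) (mul_mem_polyLE (adj_mem_polyLE hq) hr)

end Degree

/-! ### The product ultraweak topology -/

/-- The ultraweak (σ-weak) topology on `B(H)`: the coarsest topology for which the functionals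
`T ↦ ∑ₙ ⟨T ξₙ, ηₙ⟩`, with `(ξₙ)` and `(ηₙ)` square-summable sequences in `H`, are continuous.
These (absolutely convergent) series are exactly the functionals `T ↦ Tr (S T)` with `S` trace
class. -/
@[reducible] def ultraweakTopology (H : Type u) [NormedAddCommGroup H] [InnerProductSpace ℂ H] :
    TopologicalSpace (H →L[ℂ] H) :=
  ⨅ (ξ : lp (fun _ : ℕ => H) 2) (η : lp (fun _ : ℕ => H) 2),
    TopologicalSpace.induced (fun T : H →L[ℂ] H => ∑' n, inner ℂ (η n) (T (ξ n))) inferInstance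

/-- The product ultraweak topology on the polynomials of degree at most `n`: a polynomial is
identified with its tuple of coefficients, indexed by the words of length at most `n`. -/
@[reducible] def productUltraweak (H : Type u) [NormedAddCommGroup H] [InnerProductSpace ℂ H] (g n : ℕ) :
    TopologicalSpace (polyLE H g n) :=
  TopologicalSpace.induced
    (fun p (w : {w : FreeMonoid (Fin g) // w.length ≤ n}) => (p : NCPoly H g).coeff w)
    (@Pi.topologicalSpace _ _ fun _ => ultraweakTopology H)

/-! ### Linear pencils, their operator systems and their positivity domains -/

section Pencil

variable {K : Type v} [NormedAddCommGroup K] [InnerProductSpace ℂ K] {g : ℕ}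

/-- The monic linear pencil `L(x) = I + ∑ A_j x_j`. -/
def pencil (A : Fin g → (K →L[ℂ] K)) : NCPoly K g :=
  MonoidAlgebra.single 1 1 + ∑ j, MonoidAlgebra.single (FreeMonoid.of j) (A j)

/-- The members of `𝒟_L` of size `n`: the `g`-tuples of self-adjoint `n × n` matrices `X` with
`L(X) ⪰ 0`. -/
def domainOf (A : Fin g → (K →L[ℂ] K)) (n : ℕ) : Set (Fin g → Matrix (Fin n) (Fin n) ℂ) :=
  {X | (∀ j, (X j).IsHermitian) ∧
    (eval (pencil A) fun j => Matrix.toEuclideanCLM (𝕜 := ℂ) (X j)).IsPositive}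

/-- `𝒟_L` is bounded: the operator norms of the entries of its members, of all sizes, have a
common bound. -/
def DomainBounded (A : Fin g → (K →L[ℂ] K)) : Prop :=
  ∃ N : ℕ, ∀ (n : ℕ), ∀ X ∈ domainOf A n, ∀ j,
    ‖Matrix.toEuclideanCLM (𝕜 := ℂ) (X j)‖ ≤ (N : ℝ)

/-- The operator system `S_L` spanned by `I, A_1, …, A_g`. -/
def opSystem (A : Fin g → (K →L[ℂ] K)) : Submodule ℂ (K →L[ℂ] K) :=
  Submodule.span ℂ (insert 1 (Set.range A))

theorem one_mem_opSystem (A : Fin g → (K →L[ℂ] K)) : 1 ∈ opSystem A :=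
  Submodule.subset_span (Set.mem_insert _ _)

theorem coeff_mem_opSystem (A : Fin g → (K →L[ℂ] K)) (j : Fin g) : A j ∈ opSystem A :=
  Submodule.subset_span (Set.mem_insert_of_mem _ (Set.mem_range_self j))

/-- Positive semidefiniteness of a block operator matrix `[M i j]`, as an operator on `K^n`:
`⟨M v, v⟩` is real and nonnegative for all `v ∈ K^n`. -/
def BlockPos {n : ℕ} (M : Matrix (Fin n) (Fin n) (K →L[ℂ] K)) : Prop :=
  ∀ v : Fin n → K, 0 ≤ ∑ i, ∑ j, inner ℂ (v i) (M i j (v j))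

variable {H : Type u} [NormedAddCommGroup H] [InnerProductSpace ℂ H]

/-- Unital completely positive maps from the operator system `S_L` to `B(H)`. -/
structure IsUCP (A : Fin g → (K →L[ℂ] K)) (π : opSystem A →ₗ[ℂ] (H →L[ℂ] H)) : Prop where
  map_one : π ⟨1, one_mem_opSystem A⟩ = 1
  map_blockPos : ∀ (n : ℕ) (M : Matrix (Fin n) (Fin n) (opSystem A)),
    BlockPos (fun i j => (M i j : K →L[ℂ] K)) → BlockPos (fun i j => π (M i j))

/-- The pencil `π(L) = π(I) + ∑ π(A_j) x_j`. -/
def mapPencil (A : Fin g → (K →L[ℂ] K)) (π : opSystem A →ₗ[ℂ] (H →L[ℂ] H)) : NCPoly H g :=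
  MonoidAlgebra.single 1 (π ⟨1, one_mem_opSystem A⟩)
    + ∑ j, MonoidAlgebra.single (FreeMonoid.of j) (π ⟨A j, coeff_mem_opSystem A j⟩)

/-- The cone of weighted squares
`C_{d+1,d} = {r^* r + q^* π(L) q : deg r ≤ d + 1, deg q ≤ d, π ucp}`. -/
def weightedCone (H : Type u) [NormedAddCommGroup H] [InnerProductSpace ℂ H] [CompleteSpace H]
    (A : Fin g → (K →L[ℂ] K)) (d : ℕ) : Set (NCPoly H g) :=
  {p | ∃ r ∈ polyLE H g (d + 1), ∃ q ∈ polyLE H g d,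
    ∃ π : opSystem A →ₗ[ℂ] (H →L[ℂ] H), IsUCP A π ∧
      p = adj r * r + adj q * mapPencil A π * q}

theorem weightedCone_subset [CompleteSpace H] (A : Fin g → (K →L[ℂ] K)) (d : ℕ) :
    weightedCone H A d ⊆ polyLE H g (2 * d + 2) := by
  rintro p ⟨r, hr, q, hq, π, -, rfl⟩
  have hL : mapPencil A π ∈ polyLE H g 1 :=
    add_mem (single_mem_polyLE (by simp) _)
      (sum_mem fun j _ => single_mem_polyLE (by simp) _)
  exact add_mem (polyLE_mono (by omega) (mul_mem_polyLE (adj_mem_polyLE hr) hr))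
    (polyLE_mono (by omega) (mul_mem_polyLE (mul_mem_polyLE (adj_mem_polyLE hq) hL) hq))

end Pencil

end NCGNS

end

noncomputable section

namespace NCGNS

open MonoidAlgebra (single)
open InnerProductSpace (rankOne)
open ContinuousLinearMap (adjoint)
open Filter

/-! ### Algebra of polynomials and their involution. -/

section Algebra

variable {H : Type u} [NormedAddCommGroup H] [InnerProductSpace ℂ H] {g : ℕ}

/-! The proof is a truncated GNS construction on "row" polynomials. Fix a unit vector `e` and write
`x y*` for `rankOne ℂ x y`. The form `φ(p* q)` is positive semidefinite in degree at most `d + 1`.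
Let `E` be the closure of the classes of the polynomials of degree at most `d` with coefficients `e
h*`, and let `ρ` be the class map followed by projection onto `E` (`exists_rowSpace`). Left
multiplication by `x_l`, compressed to `E`, gives `Y_l`.

Positivity of `L(Y)` asks for a form with weights `⟪k i, A_l k j⟫`, while the cone only offers
weights `π(A_l)`. As `H` is infinite-dimensional, any finite-dimensional compression of the operator
system is a corner of a ucp map into `B(H)` (`exists_isUCP_inner_eq`), so `pencil_form_nonneg`
follows. Applied to a single `q`, it shows that the numbers `φ(q* x_l q) / φ(q* q)` form a size-one
member of the domain. Boundedness of the domain then makes each `Y_l` bounded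
(`exists_var_form_bound`, `exists_varOp`).

For a Hilbert basis `b` of `H`, put `γ = ∑ b i ⊗ ρ(e (b i)*)`. Its squared norm is `∑ φ((b i) (b
i)*)`, which ultraweak continuity sums to `φ(1)` (`exists_tendsto_cyclicSum`). A partial sum of `γ`
represents `φ` on coefficients compressed by a finite basis projection (`inner_opTensor_cyclicSum`),
and a second use of ultraweak continuity removes the compression. -/

theorem length_star (w : FreeMonoid (Fin g)) : (star w).length = w.length := List.length_reverse

theorem eq_sum_single (p : NCPoly H g) :
    p = ∑ w ∈ p.coeff.support, single w (p.coeff w) :=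
  (MonoidAlgebra.sum_coeff_single p).symm

/-- Induction on polynomials of bounded degree. -/
theorem polyLE_induction {n : ℕ} {motive : NCPoly H g → Prop} (zero : motive 0)
    (add : ∀ p ∈ polyLE H g n, ∀ q ∈ polyLE H g n, motive p → motive q → motive (p + q))
    (mono : ∀ w : FreeMonoid (Fin g), w.length ≤ n → ∀ P, motive (single w P))
    {p : NCPoly H g} (hp : p ∈ polyLE H g n) : motive p := by
  classical
  have key : ∀ s : Finset (FreeMonoid (Fin g)), (∀ w ∈ s, w.length ≤ n) →
      (∑ w ∈ s, single w (p.coeff w) ∈ polyLE H g n) ∧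
        motive (∑ w ∈ s, single w (p.coeff w)) := by
    intro s
    induction s using Finset.induction_on with
    | empty => exact fun _ => ⟨by simp, by simpa using zero⟩
    | insert a s ha ih =>
      intro hs
      have h1 := ih fun w hw => hs w (Finset.mem_insert_of_mem hw)
      have h2 := hs a (Finset.mem_insert_self a s)
      rw [Finset.sum_insert ha]
      exact ⟨add_mem (single_mem_polyLE h2 _) h1.1,
        add _ (single_mem_polyLE h2 _) _ h1.1 (mono a h2 _) h1.2⟩
  rw [eq_sum_single p]
  exact (key _ fun w hw => length_le_of_mem_support hp hw).2

variable [CompleteSpace H]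

@[simp] theorem adj_single (w : FreeMonoid (Fin g)) (P : H →L[ℂ] H) :
    adj (single w P : NCPoly H g) = single (star w) (star P) := by
  simp [adj]

@[simp] theorem adj_zero : adj (0 : NCPoly H g) = 0 := by simp [adj]

@[simp] theorem adj_add (p q : NCPoly H g) : adj (p + q) = adj p + adj q := by
  classical
  simp only [adj, MonoidAlgebra.coeff_add]
  exact Finsupp.sum_add_index' (by simp) (by intros; simp [MonoidAlgebra.single_add])

/-- The involution as an additive map. -/
def adjHom : NCPoly H g →+ NCPoly H g where
  toFun := adj
  map_zero' := adj_zero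
  map_add' := adj_add

theorem adj_sum {ι : Type*} (s : Finset ι) (f : ι → NCPoly H g) :
    adj (∑ i ∈ s, f i) = ∑ i ∈ s, adj (f i) :=
  map_sum (adjHom (H := H) (g := g)) f s

theorem adj_smul (c : ℂ) (p : NCPoly H g) : adj (c • p) = star c • adj p := by
  induction p using MonoidAlgebra.induction_linear with
  | zero => simp
  | add p q hp hq => simp [hp, hq]
  | single w P => simp [MonoidAlgebra.smul_single]

theorem adj_mul (p q : NCPoly H g) : adj (p * q) = adj q * adj p := by
  induction p using MonoidAlgebra.induction_linear with
  | zero => simp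
  | add p p' hp hp' => simp [add_mul, mul_add, hp, hp']
  | single w P =>
    induction q using MonoidAlgebra.induction_linear with
    | zero => simp
    | add q q' hq hq' => simp [add_mul, mul_add, hq, hq']
    | single v Q => simp [MonoidAlgebra.single_mul_single]

end Algebra

/-! ### Hilbert spaces from positive semidefinite forms. -/

section Gns

variable {V : Type u} [AddCommGroup V] [Module ℂ V]

/-- Polarization: the diagonal is real at `x + y` and at `x + I • y`, which gives the imaginary and
the real part of the identity. -/
theorem conj_symm_of_nonneg (B : V →ₗ⋆[ℂ] V →ₗ[ℂ] ℂ) (hB : ∀ x, 0 ≤ B x x) (x y : V) :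
    star (B y x) = B x y := by
  have im0 : ∀ x, (B x x).im = 0 := fun x => (Complex.nonneg_iff.mp (hB x)).2.symm
  have h1 := im0 (x + y)
  have h2 := im0 (x + Complex.I • y)
  have hx := im0 x
  have hy := im0 y
  simp only [map_add, LinearMap.add_apply, map_smulₛₗ, LinearMap.smul_apply,
    Complex.add_im, smul_eq_mul, Complex.mul_im, Complex.conj_I, Complex.mul_re, Complex.I_re,
    Complex.I_im, Complex.neg_im, Complex.neg_re, Complex.add_re, RingHom.id_apply] at h1 h2
  apply Complex.ext
  · simp; linarith
  · simp; linarith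

/-- The Gelfand-Naimark-Segal construction of a Hilbert space from a positive semidefinite form. -/
theorem exists_gns (B : V →ₗ⋆[ℂ] V →ₗ[ℂ] ℂ) (hB : ∀ x, 0 ≤ B x x) :
    ∃ (F : Type u) (_ : NormedAddCommGroup F) (_ : InnerProductSpace ℂ F) (_ : CompleteSpace F)
      (J : V →ₗ[ℂ] F), ∀ x y, inner ℂ (J x) (J y) = B x y := by
  let c : PreInnerProductSpace.Core ℂ V :=
    { inner := fun x y => B x y
      conj_inner_symm := fun x y => conj_symm_of_nonneg B hB x y
      re_inner_nonneg := fun x => (Complex.nonneg_iff.mp (hB x)).1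
      add_left := fun x y z => by simp
      smul_left := fun x y r => by simp }
  let _ : SeminormedAddCommGroup V := @InnerProductSpace.Core.toSeminormedAddCommGroup ℂ V _ _ _ c
  let _ : InnerProductSpace ℂ V := InnerProductSpace.ofCore c
  exact ⟨UniformSpace.Completion V, inferInstance, inferInstance, inferInstance,
    (UniformSpace.Completion.toComplL (𝕜 := ℂ) (E := V)).toLinearMap,
    fun x y => UniformSpace.Completion.inner_coe x y⟩

end Gns

/-! ### Operators on the Hilbert space tensor product, and positivity of the pencil. -/

section Tensor

variable {H : Type u} {E : Type v} [NormedAddCommGroup H] [InnerProductSpace ℂ H]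
  [NormedAddCommGroup E] [InnerProductSpace ℂ E] {g : ℕ}

/-- The pure tensor `h ⊗ e` in the Hilbert space tensor product. -/
def tmul (h : H) (e : E) : HilbertTensor H E := ((h ⊗ₜ[ℂ] e : H ⊗[ℂ] E) : HilbertTensor H E)

@[simp] theorem opTensor_tmul (P : H →L[ℂ] H) (T : E →L[ℂ] E) (h : H) (e : E) :
    opTensor P T (tmul h e) = tmul (P h) (T e) := opTensor_coe_tmul P T h e

@[simp] theorem inner_tmul (h h' : H) (e e' : E) :
    inner ℂ (tmul h e) (tmul h' e') = inner ℂ h h' * inner ℂ e e' := by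
  simp [tmul]

theorem tmul_induction {motive : HilbertTensor H E → Prop}
    (closed : IsClosed {x | motive x})
    (sum : ∀ (n : ℕ) (h : Fin n → H) (e : Fin n → E), motive (∑ i, tmul (h i) (e i)))
    (x : HilbertTensor H E) : motive x := by
  induction x using UniformSpace.Completion.induction_on with
  | hp => exact closed
  | ih t =>
    obtain ⟨n, h, e, rfl⟩ := TensorProduct.exists_sum_tmul_eq t
    have := sum n h e
    simp only [tmul] at this
    convert this
    exact map_sum (UniformSpace.Completion.toComplL (𝕜 := ℂ) (E := H ⊗[ℂ] E)) _ _

theorem opTensor_ext {S T : HilbertTensor H E →L[ℂ] HilbertTensor H E}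
    (h : ∀ a b, S (tmul a b) = T (tmul a b)) : S = T := by
  ext x
  induction x using tmul_induction with
  | closed => exact isClosed_eq S.continuous T.continuous
  | sum n a b => simp [h]

theorem tmul_add_left (h h' : H) (e : E) : tmul (h + h') e = tmul h e + tmul h' e := by
  simp only [tmul, TensorProduct.add_tmul]
  exact UniformSpace.Completion.coe_add _ _

theorem opTensor_add (P Q : H →L[ℂ] H) (T : E →L[ℂ] E) :
    opTensor (P + Q) T = opTensor P T + opTensor Q T :=
  opTensor_ext fun a b => by simp [tmul_add_left]

@[simp] theorem opTensor_zero (T : E →L[ℂ] E) : opTensor (0 : H →L[ℂ] H) T = 0 :=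
  opTensor_ext fun a b => by
    rw [opTensor_tmul]
    simp only [tmul, zero_apply, TensorProduct.zero_tmul]
    exact UniformSpace.Completion.coe_zero

theorem opTensor_mul (P Q : H →L[ℂ] H) (S T : E →L[ℂ] E) :
    opTensor (P * Q) (S * T) = opTensor P S * opTensor Q T :=
  opTensor_ext fun a b => by simp

theorem inner_opTensor_left [CompleteSpace H] [CompleteSpace E] (P : H →L[ℂ] H) (T : E →L[ℂ] E)
    (x y : HilbertTensor H E) :
    inner ℂ (opTensor P T x) y = inner ℂ x (opTensor (star P) (star T) y) := by
  induction x using tmul_induction with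
  | closed =>
    exact isClosed_eq ((opTensor P T).continuous.inner continuous_const)
      (continuous_id.inner continuous_const)
  | sum n h e =>
    induction y using tmul_induction with
    | closed =>
      exact isClosed_eq (continuous_const.inner continuous_id)
        (continuous_const.inner (opTensor (star P) (star T)).continuous)
    | sum m h' e' =>
      simp [sum_inner, inner_sum, ContinuousLinearMap.star_eq_adjoint,
        ContinuousLinearMap.adjoint_inner_right]

@[simp] theorem eval_single (w : FreeMonoid (Fin g)) (P : H →L[ℂ] H) (X : Fin g → (E →L[ℂ] E)) :
    eval (single w P) X = opTensor P (FreeMonoid.lift X w) := by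
  simp [eval]

@[simp] theorem eval_zero (X : Fin g → (E →L[ℂ] E)) : eval (0 : NCPoly H g) X = 0 := by
  simp [eval]

@[simp] theorem eval_add (p q : NCPoly H g) (X : Fin g → (E →L[ℂ] E)) :
    eval (p + q) X = eval p X + eval q X := by
  classical
  simp only [eval, MonoidAlgebra.coeff_add]
  exact Finsupp.sum_add_index' (by simp) (by intros; simp [opTensor_add])

theorem eval_sum {ι : Type*} (s : Finset ι) (p : ι → NCPoly H g) (X : Fin g → (E →L[ℂ] E)) :
    eval (∑ i ∈ s, p i) X = ∑ i ∈ s, eval (p i) X :=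
  map_sum (⟨⟨fun p => eval p X, eval_zero X⟩, fun p q => eval_add p q X⟩ :
    NCPoly H g →+ (HilbertTensor H E →L[ℂ] HilbertTensor H E)) p s

theorem eval_pencil (A : Fin g → (H →L[ℂ] H)) (X : Fin g → (E →L[ℂ] E)) :
    eval (pencil A) X = opTensor 1 1 + ∑ j, opTensor (A j) (X j) := by
  simp [pencil, eval_sum]

/-- The value of the form of the pencil at `∑ kᵢ ⊗ eᵢ`. -/
theorem inner_eval_pencil_sum (A : Fin g → (H →L[ℂ] H)) (X : Fin g → (E →L[ℂ] E)) {n : ℕ}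
    (k : Fin n → H) (e : Fin n → E) :
    inner ℂ (∑ i, tmul (k i) (e i)) (eval (pencil A) X (∑ i, tmul (k i) (e i)))
      = ∑ i, ∑ j, (inner ℂ (k i) (k j) * inner ℂ (e i) (e j)
          + ∑ l, inner ℂ (k i) (A l (k j)) * inner ℂ (e i) (X l (e j))) := by
  rw [sum_inner]
  refine Finset.sum_congr rfl fun i _ => ?_
  rw [map_sum, inner_sum]
  refine Finset.sum_congr rfl fun j _ => ?_
  simp only [eval_pencil, inner_sum, add_apply, sum_apply, opTensor_tmul, inner_add_right,
    inner_tmul, one_apply_eq_self]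

theorem isClosed_setOf_nonneg {X : Type*} [TopologicalSpace X] {f : X → ℂ} (hf : Continuous f) :
    IsClosed {x | 0 ≤ f x} := isClosed_Ici.preimage hf

/-- Positivity of the pencil can be tested on vectors from a dense subset. -/
theorem isPositive_eval_pencil_of_dense (A : Fin g → (H →L[ℂ] H)) (X : Fin g → (E →L[ℂ] E))
    {D : Set E} (hD : Dense D)
    (hpos : ∀ (n : ℕ) (k : Fin n → H) (e : Fin n → E), (∀ i, e i ∈ D) →
      0 ≤ ∑ i, ∑ j, (inner ℂ (k i) (k j) * inner ℂ (e i) (e j)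
          + ∑ l, inner ℂ (k i) (A l (k j)) * inner ℂ (e i) (X l (e j)))) :
    (eval (pencil A) X).IsPositive := by
  have key : ∀ x, 0 ≤ inner ℂ x (eval (pencil A) X x) := by
    intro x
    induction x using tmul_induction with
    | closed =>
      exact isClosed_setOf_nonneg
        (continuous_id.inner (𝕜 := ℂ) (eval (pencil A) X).continuous)
    | sum n k e =>
      rw [inner_eval_pencil_sum]
      have hcl : IsClosed {e : Fin n → E | 0 ≤ ∑ i, ∑ j, (inner ℂ (k i) (k j) * inner ℂ (e i) (e j)
          + ∑ l, inner ℂ (k i) (A l (k j)) * inner ℂ (e i) (X l (e j)))} := by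
        refine isClosed_setOf_nonneg ?_
        fun_prop
      have hd : Dense (Set.univ.pi fun _ : Fin n => D) := dense_pi _ fun _ _ => hD
      exact (hcl.closure_subset_iff (s := Set.univ.pi fun _ => D)).mpr
        (fun e he => hpos n k e fun i => he i trivial) (hd e)
  rw [ContinuousLinearMap.isPositive_iff_complex]
  intro x
  have h := Complex.nonneg_iff.mp (key x)
  have h' : inner ℂ (eval (pencil A) X x) x = star (inner ℂ x (eval (pencil A) X x)) :=
    (inner_conj_symm _ _).symm
  rw [h']
  generalize inner ℂ x (eval (pencil A) X x) = z at h
  constructor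
  · apply Complex.ext
    · simp
    · simpa using h.2.symm
  · simpa using h.1

end Tensor

/-! ### Ucp maps with a prescribed finite-dimensional compression. -/

section Ucp

variable {H : Type u} [NormedAddCommGroup H] [InnerProductSpace ℂ H] [CompleteSpace H]
  {K : Type v} [NormedAddCommGroup K] [InnerProductSpace ℂ K] {g : ℕ}

/-- Complete positivity of `a ↦ ⟪k₀, a k₀⟫ Q`. Expanding `⟪v i, v j⟫` by Parseval turns the sum into
a series of values of the block form on multiples of `k₀`. -/
theorem blockPos_sum_nonneg {n : ℕ} {M : Matrix (Fin n) (Fin n) (K →L[ℂ] K)} (hM : BlockPos M)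
    (k₀ : K) (v : Fin n → H) :
    0 ≤ ∑ i, ∑ j, inner ℂ k₀ (M i j k₀) * inner ℂ (v i) (v j) := by
  obtain ⟨w, b, -⟩ := exists_hilbertBasis ℂ H
  have h : HasSum (fun a => ∑ i, ∑ j,
      inner ℂ k₀ (M i j k₀) * (inner ℂ (v i) (b a) * inner ℂ (b a) (v j)))
      (∑ i, ∑ j, inner ℂ k₀ (M i j k₀) * inner ℂ (v i) (v j)) :=
    hasSum_sum fun i _ => hasSum_sum fun j _ =>
      (b.hasSum_inner_mul_inner (v i) (v j)).mul_left _
  refine h.nonneg fun a => ?_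
  convert hM fun i => inner ℂ (b a) (v i) • k₀ using 4 with i _ j _
  rw [inner_smul_left, map_smul, inner_smul_right, inner_conj_symm]
  ring

theorem exists_linearIsometry_of_infinite (hH : ¬ FiniteDimensional ℂ H) (F : Submodule ℂ K)
    [FiniteDimensional ℂ F] : Nonempty (F →ₗᵢ[ℂ] H) := by
  obtain ⟨w, b, -⟩ := exists_hilbertBasis ℂ H
  have hw : Infinite w := by
    by_contra h
    rw [not_infinite_iff_finite] at h
    cases nonempty_fintype w
    exact hH b.toOrthonormalBasis.toBasis.finiteDimensional_of_finite
  let v := stdOrthonormalBasis ℂ F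
  let f := v.toBasis.constr ℂ fun i => b (Infinite.natEmbedding w i)
  refine ⟨f.isometryOfOrthonormal (v := v.toBasis) (by simp) ?_⟩
  have : (f ∘ v.toBasis : _ → H) = b ∘ (Infinite.natEmbedding w ∘ Fin.val) := by
    ext i
    simp only [Function.comp, f, Module.Basis.constr_basis]
  rw [this]
  exact b.orthonormal.comp _ ((Infinite.natEmbedding w).injective.comp Fin.val_injective)

variable [CompleteSpace K]

/-- The map `a ↦ V* a V + ⟪k₀, a k₀⟫ Q` on the operator system of the pencil. -/
def compressionMap (A : Fin g → (K →L[ℂ] K)) (k₀ : K) (V : H →L[ℂ] K) (Q : H →L[ℂ] H) :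
    opSystem A →ₗ[ℂ] (H →L[ℂ] H) where
  toFun a := adjoint V ∘L (a : K →L[ℂ] K) ∘L V + inner ℂ k₀ ((a : K →L[ℂ] K) k₀) • Q
  map_add' a b := by
    ext x
    simp [add_smul]
    abel
  map_smul' c a := by
    ext x
    simp [mul_smul]

/-- `Q` is a projection, so both summands take the form to which block positivity applies. -/
theorem inner_compressionMap (A : Fin g → (K →L[ℂ] K)) (k₀ : K) (V : H →L[ℂ] K) {Q : H →L[ℂ] H}
    (hQ : adjoint Q ∘L Q = Q) (a : opSystem A) (x y : H) :
    inner ℂ x (compressionMap A k₀ V Q a y) = inner ℂ (V x) ((a : K →L[ℂ] K) (V y))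
      + inner ℂ k₀ ((a : K →L[ℂ] K) k₀) * inner ℂ (Q x) (Q y) := by
  have h : inner ℂ (Q x) (Q y) = inner ℂ x (Q y) := by
    conv_rhs => rw [← hQ]
    simp [ContinuousLinearMap.adjoint_inner_right]
  simp [compressionMap, h,
    ContinuousLinearMap.adjoint_inner_right]

theorem isUCP_compressionMap (A : Fin g → (K →L[ℂ] K)) {k₀ : K} (hk₀ : ‖k₀‖ = 1)
    {V : H →L[ℂ] K} {Q : H →L[ℂ] H} (hQ : adjoint Q ∘L Q = Q) (hVQ : adjoint V ∘L V + Q = 1) :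
    IsUCP A (compressionMap A k₀ V Q) where
  map_one := by
    simpa [compressionMap, inner_self_eq_norm_sq_to_K, hk₀, ContinuousLinearMap.one_def] using hVQ
  map_blockPos n M hM v := by
    simp only [inner_compressionMap A k₀ V hQ, Finset.sum_add_distrib]
    exact add_nonneg (hM fun i => V (v i)) (blockPos_sum_nonneg hM k₀ fun i => Q (v i))

/-- Every finite-dimensional compression of the operator system is part of a ucp map to `B(H)`. -/
theorem exists_isUCP_inner_eq (hH : ¬ FiniteDimensional ℂ H) [Nontrivial K]
    (A : Fin g → (K →L[ℂ] K)) {n : ℕ} (k : Fin n → K) :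
    ∃ (u : Fin n → H) (π : opSystem A →ₗ[ℂ] (H →L[ℂ] H)), IsUCP A π ∧
      ∀ i j a, inner ℂ (u i) (π a (u j)) = inner ℂ (k i) ((a : K →L[ℂ] K) (k j)) := by
  -- The vector state of `k₀` fills in the map on the complement of the embedded copy of `F`, to
  -- make it unital.
  obtain ⟨k₀, hk₀⟩ := exists_norm_eq K zero_le_one
  let F := Submodule.span ℂ (Set.range k)
  have : FiniteDimensional ℂ F := FiniteDimensional.span_of_finite ℂ (Set.finite_range k)
  obtain ⟨ι⟩ := exists_linearIsometry_of_infinite hH F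
  let I : F →L[ℂ] H := ι.toContinuousLinearMap
  have hI : adjoint I ∘L I = 1 := ContinuousLinearMap.norm_map_iff_adjoint_comp_self I |>.mp ι.norm_map
  have hI' : ∀ x, adjoint I (I x) = x := fun x => congrArg (fun T : F →L[ℂ] F => T x) hI
  -- A partial isometry inverting the embedding `I` on its range; it carries each `u i` to `k i`,
  -- while `Q` kills `u i`.
  let V : H →L[ℂ] K := F.subtypeL ∘L adjoint I
  have hV : adjoint V ∘L V = I ∘L adjoint I := by
    ext x
    refine ext_inner_left ℂ fun y => ?_
    simp only [ContinuousLinearMap.comp_apply, ContinuousLinearMap.adjoint_inner_right, V,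
      Submodule.subtypeL_apply, ← Submodule.coe_inner]
    rw [← ContinuousLinearMap.adjoint_inner_right, ContinuousLinearMap.adjoint_inner_left]
  let Q : H →L[ℂ] H := 1 - I ∘L adjoint I
  have hQ : adjoint Q ∘L Q = Q := by
    have h1 : adjoint Q = Q := by
      simp only [Q, map_sub, ContinuousLinearMap.adjoint_comp, ContinuousLinearMap.adjoint_adjoint]
      rw [← ContinuousLinearMap.star_eq_adjoint, star_one]
    rw [h1]
    ext x
    simp [Q, hI']
  let u : Fin n → H := fun i => I ⟨k i, Submodule.subset_span ⟨i, rfl⟩⟩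
  have hVu : ∀ i, V (u i) = k i := fun i => by simp [V, u, hI']
  have hQu : ∀ i, Q (u i) = 0 := fun i => by simp [Q, u, hI']
  refine ⟨u, compressionMap A k₀ V Q, isUCP_compressionMap A hk₀ hQ (by rw [hV]; simp [Q]), ?_⟩
  intro i j a
  rw [inner_compressionMap A k₀ V hQ, hVu, hVu, hQu]
  simp

end Ucp

/-! ### Positivity and boundedness of the form on row polynomials. -/

section Form

variable {H : Type u} [NormedAddCommGroup H] [InnerProductSpace ℂ H] {g : ℕ}

/-- The polynomials of degree at most `n` all of whose coefficients have range in `ℂ e`. -/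
def rowPoly (e : H) (g n : ℕ) : Submodule ℂ (NCPoly H g) where
  carrier := {q | q ∈ polyLE H g n ∧ single 1 (rankOne ℂ e e) * q = q}
  zero_mem' := ⟨zero_mem _, mul_zero _⟩
  add_mem' := fun {p q} hp hq => ⟨add_mem hp.1 hq.1, by rw [mul_add, hp.2, hq.2]⟩
  smul_mem' := fun c q hq => ⟨Submodule.smul_mem _ c hq.1, by rw [mul_smul_comm, hq.2]⟩

/-- The variable `x_l` as a polynomial. -/
def varPoly (H : Type u) [NormedAddCommGroup H] [InnerProductSpace ℂ H] (l : Fin g) : NCPoly H g :=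
  single (FreeMonoid.of l) 1

theorem varPoly_mul_mem {n : ℕ} (l : Fin g) {q : NCPoly H g} (hq : q ∈ polyLE H g n) :
    varPoly H l * q ∈ polyLE H g (n + 1) := by
  rw [add_comm]
  exact mul_mem_polyLE (single_mem_polyLE (by simp) _) hq

theorem single_mem_rowPoly {e : H} (he : ‖e‖ = 1) {n : ℕ} {w : FreeMonoid (Fin g)}
    (hw : w.length ≤ n) (h : H) : single w (rankOne ℂ e h) ∈ rowPoly e g n := by
  refine ⟨single_mem_polyLE hw _, ?_⟩
  rw [MonoidAlgebra.single_mul_single, one_mul]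
  congr 1
  ext x
  simp [inner_self_eq_norm_sq_to_K, he]

variable [CompleteSpace H] {K : Type v} [NormedAddCommGroup K] [InnerProductSpace ℂ K]

@[simp] theorem adj_varPoly (l : Fin g) : adj (varPoly H l) = varPoly H l := by
  simp [varPoly]

/-- The identity `(x e*)* T (y e*) = ⟪x, T y⟫ e e*` reduces an operator weight to a scalar, and a
row polynomial absorbs the projection `e e*`. -/
theorem adj_mul_rankOne_mul {e : H} {n : ℕ} {p q : NCPoly H g}
    (hq : q ∈ rowPoly e g n) (x y : H) (w : FreeMonoid (Fin g)) (T : H →L[ℂ] H) :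
    adj (single 1 (rankOne ℂ x e) * p) * single w T * (single 1 (rankOne ℂ y e) * q)
      = inner ℂ x (T y) • (adj p * (single w 1 * q)) := by
  have h : (single 1 (star (rankOne ℂ x e)) * single w T * single 1 (rankOne ℂ y e) : NCPoly H g)
      = inner ℂ x (T y) • (single w 1 * single 1 (rankOne ℂ e e)) := by
    simp only [MonoidAlgebra.single_mul_single, one_mul, mul_one, MonoidAlgebra.smul_single]
    congr 1
    ext z
    simp [ContinuousLinearMap.star_eq_adjoint, smul_smul, mul_comm]
  calc _ = adj p * ((single 1 (star (rankOne ℂ x e)) * single w T * single 1 (rankOne ℂ y e)) * q) := by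
        rw [adj_mul, adj_single, star_one]
        simp only [mul_assoc]
    _ = _ := by rw [h, smul_mul_assoc, mul_smul_comm, mul_assoc, hq.2]

variable [CompleteSpace K] {A : Fin g → (K →L[ℂ] K)} {d : ℕ} {Φ : NCPoly H g →ₗ[ℂ] ℂ}

theorem adj_mul_self_nonneg [Nontrivial K] (hH : ¬ FiniteDimensional ℂ H)
    (hΦ : ∀ p ∈ weightedCone H A d, 0 ≤ Φ p) {r : NCPoly H g}
    (hr : r ∈ polyLE H g (d + 1)) : 0 ≤ Φ (adj r * r) := by
  -- Membership in the cone requires some ucp map even when `q = 0`; the empty family supplies one.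
  obtain ⟨-, π, hπ, -⟩ := exists_isUCP_inner_eq (H := H) hH A (n := 0) Fin.elim0
  exact hΦ _ ⟨r, hr, 0, zero_mem _, π, hπ, by simp⟩

/-- The form of the pencil is positive semidefinite. -/
theorem pencil_form_nonneg [Nontrivial K] (hH : ¬ FiniteDimensional ℂ H)
    (hΦ : ∀ p ∈ weightedCone H A d, 0 ≤ Φ p) {e : H} {n : ℕ} (k : Fin n → K)
    (q : Fin n → NCPoly H g) (hq : ∀ i, q i ∈ rowPoly e g d) :
    0 ≤ ∑ i, ∑ j, (inner ℂ (k i) (k j) * Φ (adj (q i) * q j)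
      + ∑ l, inner ℂ (k i) (A l (k j)) * Φ (adj (q i) * (varPoly H l * q j))) := by
  obtain ⟨u, π, hπ, hu⟩ := exists_isUCP_inner_eq hH A k
  -- Placing `q i` in the direction `u i` makes the weight `π(a)` contribute the matrix entries `⟪u
  -- i, π(a) u j⟫ = ⟪k i, a k j⟫`.
  let Q : NCPoly H g := ∑ i, single 1 (rankOne ℂ (u i) e) * q i
  have hQ : Q ∈ polyLE H g d := sum_mem fun i _ => by
    simpa using mul_mem_polyLE (single_mem_polyLE (n := 0) (by simp) _) (hq i).1
  have h := hΦ _ ⟨0, zero_mem _, Q, hQ, π, hπ, rfl⟩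
  convert h using 1
  have hmono : ∀ (w : FreeMonoid (Fin g)) (a : opSystem A), Φ (adj Q * single w (π a) * Q)
      = ∑ i, ∑ j, inner ℂ (k i) ((a : K →L[ℂ] K) (k j)) * Φ (adj (q i) * (single w 1 * q j)) := by
    intro w a
    simp only [Q, adj_sum, Finset.sum_mul, Finset.mul_sum, map_sum]
    rw [Finset.sum_comm]
    simp only [adj_mul_rankOne_mul (hq _), hu, map_smul, smul_eq_mul]
  simp only [mapPencil, mul_add, add_mul, Finset.mul_sum, Finset.sum_mul, map_add, map_sum, hmono,
    adj_zero, zero_mul, zero_add, Finset.sum_add_distrib]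
  congr 1
  · simp [← MonoidAlgebra.one_def]
  · symm
    rw [Finset.sum_comm]
    refine Finset.sum_congr rfl fun i _ => ?_
    rw [Finset.sum_comm]
    rfl

/-- Boundedness of the positivity domain bounds the multiplication form of each variable. -/
theorem exists_var_form_bound [Nontrivial K] (hH : ¬ FiniteDimensional ℂ H)
    (hbdd : DomainBounded A)
    (hΦ : ∀ p ∈ weightedCone H A d, 0 ≤ Φ p) {e : H} :
    ∃ N : ℝ, 0 ≤ N ∧ ∀ q ∈ rowPoly e g d, (∀ l, (Φ (adj q * (varPoly H l * q))).im = 0) →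
      0 < Φ (adj q * q) → ∀ l, ‖Φ (adj q * (varPoly H l * q))‖ ≤ N * (Φ (adj q * q)).re := by
  obtain ⟨N, hN⟩ := hbdd
  refine ⟨N, by positivity, fun q hq him hpos l => ?_⟩
  obtain ⟨hs, hs'⟩ := Complex.pos_iff.mp hpos
  set s : ℝ := (Φ (adj q * q)).re with hs_def
  have hsΦ : Φ (adj q * q) = (s : ℂ) := Complex.ext rfl hs'.symm
  let z : Fin g → ℂ := fun l => Φ (adj q * (varPoly H l * q)) / s
  have hz : ∀ l, star (z l) = z l := fun l => by
    simp only [z, star_div₀]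
    congr 1
    · exact Complex.conj_eq_iff_im.mpr (him l)
    · exact Complex.conj_ofReal s
  let X : Fin g → Matrix (Fin 1) (Fin 1) ℂ := fun l => z l • 1
  have hX : ∀ l, Matrix.toEuclideanCLM (𝕜 := ℂ) (X l) = z l • 1 := fun l => by
    simp only [X, map_smul, map_one]
  have hmem : X ∈ domainOf A 1 := by
    refine ⟨fun l => ?_, ?_⟩
    · rw [Matrix.IsHermitian, Matrix.conjTranspose_smul, hz, Matrix.conjTranspose_one]
    · refine isPositive_eval_pencil_of_dense A _ dense_univ fun n k c _ => ?_
      -- The pencil form at the multiples `c i 0 • q` is `s` times the quadratic form of the scalar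
      -- pencil.
      have h := pencil_form_nonneg hH hΦ (e := e) k (fun i => c i 0 • q)
        fun i => Submodule.smul_mem _ _ hq
      have hinv : (0 : ℂ) ≤ (s : ℂ)⁻¹ := by
        rw [← Complex.ofReal_inv]; exact_mod_cast (inv_pos.mpr hs).le
      convert mul_nonneg hinv h using 1
      have hs0 : (s : ℂ) ≠ 0 := by exact_mod_cast hs.ne'
      simp only [Finset.mul_sum, mul_add]
      refine Finset.sum_congr rfl fun i _ => Finset.sum_congr rfl fun j _ => ?_
      simp only [hX, adj_smul, smul_mul_assoc, mul_smul_comm, map_smul, hsΦ]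
      congr 1
      · simp [PiLp.inner_apply]
        field_simp
      · refine Finset.sum_congr rfl fun l _ => ?_
        simp [PiLp.inner_apply, z]
        field_simp
  have h := hN 1 X hmem l
  rw [hX, norm_smul, norm_one, mul_one, norm_div, Complex.norm_real, Real.norm_of_nonneg hs.le,
    div_le_iff₀ hs] at h
  exact h

end Form

/-! ### Ultraweak continuity, tested on bounded weakly convergent families. -/

section Ultraweak

variable {H : Type u} [NormedAddCommGroup H] [InnerProductSpace ℂ H] {g n : ℕ}

/-- Bounded weak operator convergence implies ultraweak convergence. -/
theorem tendsto_ultraweak {α : Type*} {l : Filter α} {f : α → (H →L[ℂ] H)} {T : H →L[ℂ] H}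
    {C : ℝ} (hb : ∀ᶠ a in l, ‖f a‖ ≤ C)
    (hf : ∀ x y, Tendsto (fun a => inner ℂ y (f a x)) l (𝓝 (inner ℂ y (T x)))) :
    Tendsto f l (@nhds _ (ultraweakTopology H) T) := by
  simp only [nhds_iInf, tendsto_iInf, nhds_induced, tendsto_comap_iff]
  intro ξ η
  have hs : Summable fun k => ‖ξ k‖ * ‖η k‖ :=
    lp.summable_mul (p := 2) (q := 2) (by simpa using Real.HolderConjugate.two_two) ξ η
  refine tendsto_tsum_of_dominated_convergence (hs.mul_left C) (fun k => hf _ _) ?_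
  filter_upwards [hb] with a ha k
  calc ‖inner ℂ (η k) (f a (ξ k))‖ ≤ ‖η k‖ * ‖f a (ξ k)‖ := norm_inner_le_norm _ _
    _ ≤ ‖η k‖ * (C * ‖ξ k‖) := by
        gcongr
        exact (f a).le_of_opNorm_le ha _
    _ = C * (‖ξ k‖ * ‖η k‖) := by ring

/-- `Φ` is continuous on each coefficient for bounded weak operator convergence. -/
def IsNormalOn (Φ : NCPoly H g →ₗ[ℂ] ℂ) (n : ℕ) : Prop :=
  ∀ (w : FreeMonoid (Fin g)), w.length ≤ n → ∀ {α : Type u} (l : Filter α) (f : α → (H →L[ℂ] H))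
    (T : H →L[ℂ] H) (C : ℝ), (∀ᶠ a in l, ‖f a‖ ≤ C) →
    (∀ x y, Tendsto (fun a => inner ℂ y (f a x)) l (𝓝 (inner ℂ y (T x)))) →
    Tendsto (fun a => Φ (single w (f a))) l (𝓝 (Φ (single w T)))

/-- A monomial varies in one coordinate of the product only, so ultraweak convergence of its
coefficient is convergence in the product topology. -/
theorem isNormalOn_of_continuous {φ : polyLE H g n →ₗ[ℂ] ℂ}
    (hφ : Continuous[productUltraweak H g n, inferInstance] φ) {Φ : NCPoly H g →ₗ[ℂ] ℂ}
    (hΦ : ∀ p : polyLE H g n, Φ p = φ p) : IsNormalOn Φ n := by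
  classical
  intro w hw α l f T C hb hf
  have hlim : Tendsto (fun a => (⟨single w (f a), single_mem_polyLE hw _⟩ : polyLE H g n)) l
      (@nhds _ (productUltraweak H g n) ⟨single w T, single_mem_polyLE hw _⟩) := by
    let _ := ultraweakTopology H
    rw [productUltraweak, nhds_induced, tendsto_comap_iff, nhds_pi, tendsto_pi]
    rintro ⟨v, hv⟩
    by_cases h : w = v
    · subst h
      simpa [Function.comp_def] using tendsto_ultraweak hb hf
    · simpa [Function.comp_def, Finsupp.single_apply, h] using tendsto_const_nhds
  have h := (@Continuous.tendsto _ _ (productUltraweak H g n) _ _ hφ _).comp hlim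
  simpa [Function.comp_def, ← hΦ] using h

end Ultraweak

/-! ### Bounded self-adjoint operators from quadratic form bounds. -/

section SelfAdjoint

variable {V : Type u} [AddCommGroup V] [Module ℂ V]
  {E : Type u} [NormedAddCommGroup E] [InnerProductSpace ℂ E]

/-- The form `(v, w) ↦ c ⟪a v, a w⟫ + ⟪a v, b w⟫`. -/
def shiftedForm (a b : V →ₗ[ℂ] E) (c : ℝ) : V →ₗ⋆[ℂ] V →ₗ[ℂ] ℂ :=
  LinearMap.mk₂'ₛₗ (starRingEnd ℂ) (RingHom.id ℂ)
    (fun v w => c * inner ℂ (a v) (a w) + inner ℂ (a v) (b w))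
    (fun p q r => by simp only [map_add, inner_add_left]; ring)
    (fun c p q => by simp only [map_smul, inner_smul_left, smul_eq_mul]; ring)
    (fun p q r => by simp only [map_add, inner_add_right]; ring)
    (fun c p q => by simp only [map_smul, inner_smul_right, smul_eq_mul, RingHom.id_apply]; ring)

theorem shiftedForm_apply (a b : V →ₗ[ℂ] E) (c : ℝ) (v w : V) :
    shiftedForm a b c v w = c * inner ℂ (a v) (a w) + inner ℂ (a v) (b w) := rfl

variable {a b : V →ₗ[ℂ] E} {c : ℝ}

theorem shiftedForm_re_self (v : V) :
    (shiftedForm a b c v v).re = c * ‖a v‖ ^ 2 + (inner ℂ (a v) (b v) : ℂ).re := by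
  have h : (inner ℂ (a v) (a v) : ℂ) = ((‖a v‖ ^ 2 : ℝ) : ℂ) := by
    rw [inner_self_eq_norm_sq_to_K]; norm_cast
  rw [shiftedForm_apply, h, Complex.add_re, ← Complex.ofReal_mul, Complex.ofReal_re]

theorem shiftedForm_self_nonneg (him : ∀ v, (inner ℂ (a v) (b v) : ℂ).im = 0)
    (hre : ∀ v, |(inner ℂ (a v) (b v) : ℂ).re| ≤ c * ‖a v‖ ^ 2) (v : V) :
    0 ≤ shiftedForm a b c v v := by
  refine Complex.nonneg_iff.mpr ⟨?_, ?_⟩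
  · rw [shiftedForm_re_self]
    linarith [(abs_le.mp (hre v)).1]
  · have h : (inner ℂ (a v) (a v) : ℂ) = ((‖a v‖ ^ 2 : ℝ) : ℂ) := by
      rw [inner_self_eq_norm_sq_to_K]; norm_cast
    rw [shiftedForm_apply, h, Complex.add_im, him, ← Complex.ofReal_mul, Complex.ofReal_im, add_zero]

theorem inner_symm_of_real_diag (him : ∀ v, (inner ℂ (a v) (b v) : ℂ).im = 0)
    (hre : ∀ v, |(inner ℂ (a v) (b v) : ℂ).re| ≤ c * ‖a v‖ ^ 2) (v w : V) :
    inner ℂ (b v) (a w) = inner ℂ (a v) (b w) := by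
  have h := conj_symm_of_nonneg (shiftedForm a b c) (shiftedForm_self_nonneg him hre) v w
  simp only [shiftedForm_apply, star_add, star_mul', Complex.star_def, Complex.conj_ofReal,
    inner_conj_symm] at h
  exact add_left_cancel h

/-- Shifting by `c` gives a positive form with diagonal at most `2c‖a v‖²`. Cauchy–Schwarz costs
`2c` and undoing the shift costs `c`, hence the constant `3c`. -/
theorem norm_inner_le_of_diag (hc : 0 ≤ c) (him : ∀ v, (inner ℂ (a v) (b v) : ℂ).im = 0)
    (hre : ∀ v, |(inner ℂ (a v) (b v) : ℂ).re| ≤ c * ‖a v‖ ^ 2) (v w : V) :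
    ‖(inner ℂ (a v) (b w) : ℂ)‖ ≤ 3 * c * ‖a v‖ * ‖a w‖ := by
  obtain ⟨F, _, _, _, J, hJ⟩ := exists_gns (shiftedForm a b c) (shiftedForm_self_nonneg him hre)
  have hJn : ∀ p, ‖J p‖ ^ 2 ≤ 2 * c * ‖a p‖ ^ 2 := fun p => by
    have h : ‖J p‖ ^ 2 = (shiftedForm a b c p p).re := by
      rw [← hJ, inner_self_eq_norm_sq_to_K]
      norm_cast
    rw [h, shiftedForm_re_self]
    linarith [(abs_le.mp (hre p)).2]
  have h1 : ‖shiftedForm a b c v w‖ ≤ 2 * c * (‖a v‖ * ‖a w‖) := by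
    rw [← hJ]
    refine (norm_inner_le_norm _ _).trans (abs_le_of_sq_le_sq' ?_ (by positivity)).2
    calc (‖J v‖ * ‖J w‖) ^ 2 = ‖J v‖ ^ 2 * ‖J w‖ ^ 2 := by ring
      _ ≤ (2 * c * ‖a v‖ ^ 2) * (2 * c * ‖a w‖ ^ 2) :=
        mul_le_mul (hJn _) (hJn _) (by positivity) (by positivity)
      _ = _ := by ring
  have h2 : ‖(c : ℂ) * inner ℂ (a v) (a w)‖ ≤ c * (‖a v‖ * ‖a w‖) := by
    rw [norm_mul, Complex.norm_real, Real.norm_of_nonneg hc]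
    gcongr
    exact norm_inner_le_norm _ _
  have h3 : (inner ℂ (a v) (b w) : ℂ) = shiftedForm a b c v w - c * inner ℂ (a v) (a w) := by
    rw [shiftedForm_apply]; ring
  rw [h3]
  refine (norm_sub_le _ _).trans ((add_le_add h1 h2).trans (le_of_eq ?_))
  ring

/-- A form with real and bounded quadratic form comes from a bounded self-adjoint operator. -/
theorem exists_isSelfAdjoint_of_form [CompleteSpace E] (a b : V →ₗ[ℂ] E) (ha : DenseRange a)
    (hc : 0 ≤ c) (him : ∀ v, (inner ℂ (a v) (b v) : ℂ).im = 0)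
    (hre : ∀ v, |(inner ℂ (a v) (b v) : ℂ).re| ≤ c * ‖a v‖ ^ 2) :
    ∃ Y : E →L[ℂ] E, IsSelfAdjoint Y ∧ ∀ v, Y (a v) = b v := by
  have hop : ∀ w, ‖b w‖ ≤ 3 * c * ‖a w‖ := by
    intro w
    have hall : ∀ z : E, ‖(inner ℂ z (b w) : ℂ)‖ ≤ 3 * c * ‖z‖ * ‖a w‖ := fun z =>
      ha.induction_on z (isClosed_le (by fun_prop) (by fun_prop))
        fun v => norm_inner_le_of_diag hc him hre v w
    by_cases h0 : b w = 0
    · rw [h0, norm_zero]; positivity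
    -- Testing against `z = b w` itself bounds its norm after cancelling one factor.
    · have h := hall (b w)
      rw [inner_self_eq_norm_sq_to_K, norm_pow, RCLike.norm_ofReal, abs_norm] at h
      have hp : 0 < ‖b w‖ := norm_pos_iff.mpr h0
      refine le_of_mul_le_mul_left (h.trans' (sq _).ge |>.trans (le_of_eq ?_)) hp
      ring
  have hY : ∀ v, b.extendOfNorm a (a v) = b v := LinearMap.extendOfNorm_eq ha ⟨3 * c, hop⟩
  refine ⟨b.extendOfNorm a, ?_, hY⟩
  rw [ContinuousLinearMap.isSelfAdjoint_iff_isSymmetric]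
  intro x y
  refine ha.induction_on₂ (p := fun x y => inner ℂ (b.extendOfNorm a x) y
    = inner ℂ x (b.extendOfNorm a y)) (isClosed_eq (by fun_prop) (by fun_prop)) (fun v w => ?_) x y
  rw [hY, hY, inner_symm_of_real_diag him hre]

end SelfAdjoint

/-! ### The row Hilbert space. -/

section RowSpace

variable {H : Type u} [NormedAddCommGroup H] [InnerProductSpace ℂ H] [CompleteSpace H] {g d : ℕ}
  {Φ : NCPoly H g →ₗ[ℂ] ℂ} {e : H}

/-- The sesquilinear form `(p, q) ↦ Φ (p* q)`. -/
def adjForm (Φ : NCPoly H g →ₗ[ℂ] ℂ) (S : Submodule ℂ (NCPoly H g)) : S →ₗ⋆[ℂ] S →ₗ[ℂ] ℂ :=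
  LinearMap.mk₂'ₛₗ (starRingEnd ℂ) (RingHom.id ℂ) (fun p q => Φ (adj (p : NCPoly H g) * q))
    (fun p q r => by simp [add_mul]) (fun c p q => by simp [adj_smul])
    (fun p q r => by simp [mul_add]) (fun c p q => by simp)

theorem star_adj_mul (hpos : ∀ r ∈ polyLE H g (d + 1), 0 ≤ Φ (adj r * r)) {p q : NCPoly H g}
    (hp : p ∈ polyLE H g (d + 1)) (hq : q ∈ polyLE H g (d + 1)) :
    star (Φ (adj q * p)) = Φ (adj p * q) :=
  conj_symm_of_nonneg (adjForm Φ (polyLE H g (d + 1))) 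
    (fun r : polyLE H g (d + 1) => hpos r r.2) ⟨p, hp⟩ ⟨q, hq⟩

/-- The Hilbert space generated by the polynomials with coefficients of range in `ℂ e`, with the
classes of the polynomials of degree `d + 1` projected onto it. -/
theorem exists_rowSpace (hpos : ∀ r ∈ polyLE H g (d + 1), 0 ≤ Φ (adj r * r)) (e : H) :
    ∃ (E : Type u) (_ : NormedAddCommGroup E) (_ : InnerProductSpace ℂ E) (_ : CompleteSpace E)
      (ρ : NCPoly H g →ₗ[ℂ] E),
      (∀ p ∈ rowPoly e g d, ∀ q ∈ polyLE H g (d + 1), inner ℂ (ρ p) (ρ q) = Φ (adj p * q)) ∧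
      Dense (ρ '' (rowPoly e g d : Set (NCPoly H g))) := by
  obtain ⟨F, _, _, _, J₀, hJ₀⟩ := exists_gns (adjForm Φ (polyLE H g (d + 1)))
    fun r : polyLE H g (d + 1) => hpos r r.2
  -- The extension beyond degree `d + 1` is arbitrary; it only makes `ρ` total.
  obtain ⟨J, hJ⟩ := LinearMap.exists_extend J₀
  have hJ' : ∀ p (hp : p ∈ polyLE H g (d + 1)), J p = J₀ ⟨p, hp⟩ := fun p hp =>
    congrArg (fun T : polyLE H g (d + 1) →ₗ[ℂ] F => T ⟨p, hp⟩) hJ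
  -- Stopping at degree `d` leaves room for one variable: `x_l q` still has a class in `F`, and
  -- projecting it preserves its inner products with `E`.
  let E := ((rowPoly e g d).map J).topologicalClosure
  have hmem : ∀ p ∈ rowPoly e g d, J p ∈ E := fun p hp =>
    Submodule.le_topologicalClosure _ (Submodule.mem_map_of_mem hp)
  have hcomplete : CompleteSpace E :=
    (Submodule.isClosed_topologicalClosure _).completeSpace_coe
  have hP : ∀ p (hp : p ∈ rowPoly e g d), E.orthogonalProjectionOnto (J p) = ⟨J p, hmem p hp⟩ :=
    fun p hp => E.orthogonalProjectionOnto_mem_subspace_eq_self ⟨J p, hmem p hp⟩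
  refine ⟨E, inferInstance, inferInstance, hcomplete,
    E.orthogonalProjectionOnto.toLinearMap ∘ₗ J, ?_, ?_⟩
  · intro p hp q hq
    change inner ℂ (E.orthogonalProjectionOnto (J p)) (E.orthogonalProjectionOnto (J q)) = _
    rw [hP p hp, E.inner_orthogonalProjectionOnto_eq_of_mem_left]
    change inner ℂ (J p) (J q) = _
    rw [hJ' p (polyLE_mono (Nat.le_succ d) hp.1), hJ' q hq, hJ₀]
    rfl
  · intro x
    rw [Topology.IsInducing.subtypeVal.closure_eq_preimage_closure_image, Set.mem_preimage]
    have h : (Subtype.val : E → F) '' ((E.orthogonalProjectionOnto.toLinearMap ∘ₗ J) ''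
        (rowPoly e g d : Set (NCPoly H g))) = (rowPoly e g d).map J := by
      rw [Set.image_image, Submodule.map_coe]
      exact Set.image_congr fun p hp => congrArg Subtype.val (hP p hp)
    exact (congrArg (fun s => (x : F) ∈ closure s) h).mpr x.2

end RowSpace

/-! ### Compressed multiplication operators. -/

section RowOperators

variable {H : Type u} [NormedAddCommGroup H] [InnerProductSpace ℂ H] [CompleteSpace H] {g d : ℕ}
  {Φ : NCPoly H g →ₗ[ℂ] ℂ} {e : H}
  {E : Type u} [NormedAddCommGroup E] [InnerProductSpace ℂ E] [CompleteSpace E]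
  {ρ : NCPoly H g →ₗ[ℂ] E}

/-- The multiplication operators compressed to the row space. -/
theorem exists_varOp (hpos : ∀ r ∈ polyLE H g (d + 1), 0 ≤ Φ (adj r * r))
    (hρ : ∀ p ∈ rowPoly e g d, ∀ q ∈ polyLE H g (d + 1), inner ℂ (ρ p) (ρ q) = Φ (adj p * q))
    (hd : Dense (ρ '' (rowPoly e g d : Set (NCPoly H g)))) {N : ℝ} (hN : 0 ≤ N)
    (hbound : ∀ q ∈ rowPoly e g d, (∀ l, (Φ (adj q * (varPoly H l * q))).im = 0) →
      0 < Φ (adj q * q) → ∀ l, ‖Φ (adj q * (varPoly H l * q))‖ ≤ N * (Φ (adj q * q)).re) :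
    ∃ Y : Fin g → (E →L[ℂ] E), (∀ l, IsSelfAdjoint (Y l)) ∧
      ∀ l, ∀ q ∈ rowPoly e g d, Y l (ρ q) = ρ (varPoly H l * q) := by
  suffices h : ∀ l, ∃ Y : E →L[ℂ] E, IsSelfAdjoint Y ∧
      ∀ q ∈ rowPoly e g d, Y (ρ q) = ρ (varPoly H l * q) by
    choose Y h1 h2 using h
    exact ⟨Y, h1, h2⟩
  intro l
  have hle : ∀ {q : NCPoly H g}, q ∈ rowPoly e g d → q ∈ polyLE H g (d + 1) := fun hq =>
    polyLE_mono (Nat.le_succ d) hq.1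
  have hx : ∀ l {q : NCPoly H g}, q ∈ rowPoly e g d → varPoly H l * q ∈ polyLE H g (d + 1) :=
    fun l q hq => varPoly_mul_mem l hq.1
  have him : ∀ q ∈ rowPoly e g d, ∀ l, (Φ (adj q * (varPoly H l * q))).im = 0 := by
    refine fun q hq l => Complex.conj_eq_iff_im.mp ?_
    refine (star_adj_mul hpos (hx l hq) (hle hq)).trans ?_
    rw [adj_mul, adj_varPoly, mul_assoc]
  obtain ⟨a, ha⟩ : ∃ a : rowPoly e g d →ₗ[ℂ] E, ∀ q, a q = ρ q :=
    ⟨ρ ∘ₗ (rowPoly e g d).subtype, fun _ => rfl⟩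
  obtain ⟨b, hb⟩ : ∃ b : rowPoly e g d →ₗ[ℂ] E, ∀ q, b q = ρ (varPoly H l * q) :=
    ⟨ρ ∘ₗ LinearMap.mulLeft ℂ (varPoly H l) ∘ₗ (rowPoly e g d).subtype, fun _ => rfl⟩
  have hem : DenseRange a := by
    rw [DenseRange]
    convert hd using 1
    ext z
    simp [ha]
  have him' : ∀ q, (inner ℂ (a q) (b q) : ℂ).im = 0 := by
    rintro ⟨q, hq⟩
    rw [ha, hb, hρ q hq _ (hx l hq), him q hq]
  have hre : ∀ q, |(inner ℂ (a q) (b q) : ℂ).re| ≤ N * ‖a q‖ ^ 2 := by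
    rintro ⟨q, hq⟩
    rw [ha, hb]
    have hnorm : Φ (adj q * q) = ((‖ρ q‖ ^ 2 : ℝ) : ℂ) := by
      rw [← hρ q hq q (hle hq), inner_self_eq_norm_sq_to_K]
      norm_cast
    -- The bound on the variable form needs `Φ(q* q) > 0`, so null vectors are treated apart.
    by_cases h0 : ρ q = 0
    · simp [h0]
    · have h := hbound q hq (him q hq)
        (by rw [hnorm]; exact_mod_cast (by positivity : 0 < ‖ρ q‖ ^ 2)) l
      rw [hnorm, Complex.ofReal_re] at h
      rw [hρ q hq _ (hx l hq)]
      exact (Complex.abs_re_le_norm _).trans h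
  obtain ⟨Y, hY, hYρ⟩ := exists_isSelfAdjoint_of_form (V := rowPoly e g d) (E := E) a b hem hN him' hre
  refine ⟨Y, hY, fun q hq => ?_⟩
  rw [← ha ⟨q, hq⟩, hYρ, hb]

end RowOperators

/-! ### Action of words, separability, positivity and the cyclic vector. -/

section Representation

variable {H : Type u} [NormedAddCommGroup H] [InnerProductSpace ℂ H] {g d : ℕ}
  {Φ : NCPoly H g →ₗ[ℂ] ℂ} {e : H}
  {E : Type u} [NormedAddCommGroup E] [InnerProductSpace ℂ E]
  {ρ : NCPoly H g →ₗ[ℂ] E}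

/-- The operators act on the row space by left multiplication. -/
theorem lift_apply_row (he : ‖e‖ = 1) {Y : Fin g → (E →L[ℂ] E)}
    (hY : ∀ l, ∀ q ∈ rowPoly e g d, Y l (ρ q) = ρ (varPoly H l * q))
    (w : FreeMonoid (Fin g)) (hw : w.length ≤ d + 1) (x : H) :
    FreeMonoid.lift Y w (ρ (single 1 (rankOne ℂ e x))) = ρ (single w (rankOne ℂ e x)) := by
  induction w using FreeMonoid.inductionOn' with
  | one => simp
  | of_mul l w ih =>
    rw [FreeMonoid.length_mul, FreeMonoid.length_of] at hw
    -- `Y l` acts on a row polynomial of degree at most `d`, so only the outermost letter may reach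
    -- degree `d + 1`.
    rw [map_mul, FreeMonoid.lift_eval_of, mul_apply_eq_comp, ih (by omega),
      hY l _ (single_mem_rowPoly he (by omega) x), varPoly, MonoidAlgebra.single_mul_single,
      one_mul]

section BasisProj

variable {ι : Type u} (b : HilbertBasis ι ℂ H)

/-- The projection onto the span of finitely many basis vectors. -/
def basisProj (s : Finset ι) : H →L[ℂ] H := ∑ i ∈ s, rankOne ℂ (b i) (b i)

theorem tendsto_basisProj (x : H) :
    Tendsto (fun s => basisProj b s x) atTop (𝓝 x) := by
  have h := b.hasSum_repr x
  rw [HasSum] at h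
  simpa [basisProj, b.repr_apply_apply] using h

end BasisProj

variable [CompleteSpace H]

theorem star_rankOne_mul_rankOne (he : ‖e‖ = 1) (x y : H) :
    star (rankOne ℂ e x) * rankOne ℂ e y = rankOne ℂ x y := by
  ext z
  simp [ContinuousLinearMap.star_eq_adjoint, inner_self_eq_norm_sq_to_K, he]

/-- The Gram kernel of the row space. -/
theorem inner_row_row (he : ‖e‖ = 1)
    (hρ : ∀ p ∈ rowPoly e g d, ∀ q ∈ polyLE H g (d + 1), inner ℂ (ρ p) (ρ q) = Φ (adj p * q))
    {v w : FreeMonoid (Fin g)} (hv : v.length ≤ d) (hw : w.length ≤ d + 1) (x y : H) :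
    inner ℂ (ρ (single v (rankOne ℂ e x))) (ρ (single w (rankOne ℂ e y)))
      = Φ (single (star v * w) (rankOne ℂ x y)) := by
  rw [hρ _ (single_mem_rowPoly he hv x) _ (single_mem_polyLE hw _), adj_single,
    MonoidAlgebra.single_mul_single, star_rankOne_mul_rankOne he]

/-- The squared distance of two values is `Φ` at `w* w` with coefficient `(y - x)(y - x)*`. This
rank-one operator tends to zero in norm, so normality applies. -/
theorem continuous_row (he : ‖e‖ = 1) (hn : IsNormalOn Φ (2 * d + 2))
    (hρ : ∀ p ∈ rowPoly e g d, ∀ q ∈ polyLE H g (d + 1), inner ℂ (ρ p) (ρ q) = Φ (adj p * q))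
    {w : FreeMonoid (Fin g)} (hw : w.length ≤ d) :
    Continuous fun x : H => ρ (single w (rankOne ℂ e x)) := by
  rw [continuous_iff_continuousAt]
  intro x
  rw [ContinuousAt, tendsto_iff_norm_sub_tendsto_zero]
  have hsq : ∀ y : H, ‖ρ (single w (rankOne ℂ e y)) - ρ (single w (rankOne ℂ e x))‖ ^ 2
      = (Φ (single (star w * w) (rankOne ℂ (y - x) (y - x)))).re := by
    intro y
    rw [← inner_row_row he hρ hw (hw.trans (Nat.le_succ d)), inner_self_eq_norm_sq_to_K,
      map_sub (rankOne ℂ e), ← map_sub ρ]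
    have : (single w (rankOne ℂ e y) - single w (rankOne ℂ e x) : NCPoly H g)
        = single w (rankOne ℂ e y - rankOne ℂ e x) :=
      (map_sub (MonoidAlgebra.singleAddHom w : (H →L[ℂ] H) →+ NCPoly H g) _ _).symm
    rw [this]
    norm_cast
  have hlim : Tendsto (fun y : H => rankOne ℂ (y - x) (y - x)) (𝓝 x) (𝓝 (0 : H →L[ℂ] H)) := by
    rw [tendsto_zero_iff_norm_tendsto_zero]
    have hc : Continuous fun y : H => ‖y - x‖ * ‖y - x‖ := by fun_prop
    simpa only [InnerProductSpace.norm_rankOne, sub_self, norm_zero, mul_zero] using hc.tendsto x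
  have hlen : (star w * w).length ≤ 2 * d + 2 := by
    rw [FreeMonoid.length_mul, length_star]
    omega
  have h := hn _ hlen (𝓝 x) _ 0 1
    ((hlim.norm.eventually_lt_const (by simp : ‖(0 : H →L[ℂ] H)‖ < 1)).mono fun _ h => h.le)
    (fun u v => by
      have hc : Continuous fun T : H →L[ℂ] H => (inner ℂ v (T u) : ℂ) := by fun_prop
      exact (hc.tendsto 0).comp hlim)
  have h2 := (Complex.continuous_re.tendsto _).comp h
  simp only [Function.comp_def, ← hsq, MonoidAlgebra.single_zero, map_zero, Complex.zero_re] at h2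
  have h3 := (Real.continuous_sqrt.tendsto _).comp h2
  simpa [Function.comp_def, Real.sqrt_sq (norm_nonneg _)] using h3

/-- There are countably many words, each contributing a continuous image of the separable space `H`,
and these images span a dense subspace. -/
theorem separableSpace_of_row [TopologicalSpace.SeparableSpace H] (he : ‖e‖ = 1)
    (hn : IsNormalOn Φ (2 * d + 2))
    (hρ : ∀ p ∈ rowPoly e g d, ∀ q ∈ polyLE H g (d + 1), inner ℂ (ρ p) (ρ q) = Φ (adj p * q))
    (hd : Dense (ρ '' (rowPoly e g d : Set (NCPoly H g)))) :
    TopologicalSpace.SeparableSpace E := by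
  let s : Set E := ⋃ w : {w : FreeMonoid (Fin g) // w.length ≤ d},
    Set.range fun x : H => ρ (single w.1 (rankOne ℂ e x))
  have : Countable (FreeMonoid (Fin g)) := inferInstanceAs (Countable (List (Fin g)))
  have hs : TopologicalSpace.IsSeparable s := TopologicalSpace.IsSeparable.iUnion fun w =>
    TopologicalSpace.isSeparable_range (continuous_row he hn hρ w.2)
  have hspan : ρ '' (rowPoly e g d : Set (NCPoly H g)) ⊆ Submodule.span ℂ s := by
    rintro _ ⟨q, ⟨hq, hqe⟩, rfl⟩
    rw [SetLike.mem_coe, ← hqe]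
    refine polyLE_induction (motive := fun q => ρ (single 1 (rankOne ℂ e e) * q) ∈
      Submodule.span ℂ s) (by simp) (fun p _ q _ hp hq => ?_) (fun w hw P => ?_) hq
    · rw [mul_add, map_add]
      exact add_mem hp hq
    · refine Submodule.subset_span (Set.mem_iUnion.mpr ⟨⟨w, hw⟩, star P e, ?_⟩)
      -- Compressing the range of `P` to the line of `e` again gives a row coefficient, `e (P* e)*`.
      have h : rankOne ℂ e (star P e) = rankOne ℂ e e * P := by
        ext z
        simp [ContinuousLinearMap.star_eq_adjoint, ContinuousLinearMap.adjoint_inner_left]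
      simp only [MonoidAlgebra.single_mul_single, one_mul, h]
  have huniv : TopologicalSpace.IsSeparable (Set.univ : Set E) :=
    (hs.span (R := ℂ)).closure.mono fun x _ => closure_mono hspan (hd x)
  exact TopologicalSpace.isSeparable_univ_iff.mp huniv

theorem isPositive_eval_pencil_of_row {K : Type v} [NormedAddCommGroup K] [InnerProductSpace ℂ K]
    [CompleteSpace K] [Nontrivial K] {A : Fin g → (K →L[ℂ] K)} (hH : ¬ FiniteDimensional ℂ H)
    (hΦ : ∀ p ∈ weightedCone H A d, 0 ≤ Φ p)
    (hρ : ∀ p ∈ rowPoly e g d, ∀ q ∈ polyLE H g (d + 1), inner ℂ (ρ p) (ρ q) = Φ (adj p * q))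
    (hd : Dense (ρ '' (rowPoly e g d : Set (NCPoly H g)))) {Y : Fin g → (E →L[ℂ] E)}
    (hY : ∀ l, ∀ q ∈ rowPoly e g d, Y l (ρ q) = ρ (varPoly H l * q)) :
    (eval (pencil A) Y).IsPositive := by
  refine isPositive_eval_pencil_of_dense A Y hd fun n k x hx => ?_
  choose q hq hqx using hx
  convert pencil_form_nonneg hH hΦ k q hq using 1
  refine Finset.sum_congr rfl fun i _ => Finset.sum_congr rfl fun j _ => ?_
  simp only [← hqx, hY _ _ (hq j)]
  rw [hρ _ (hq i) _ (polyLE_mono (Nat.le_succ d) (hq j).1)]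
  simp only [hρ _ (hq i) _ (varPoly_mul_mem _ (hq j).1)]

variable {ι : Type u} (b : HilbertBasis ι ℂ H)

theorem isStarProjection_basisProj (s : Finset ι) : IsStarProjection (basisProj b s) where
  isIdempotentElem := by
    classical
    ext x
    simp [basisProj, orthonormal_iff_ite.mp b.orthonormal]
  isSelfAdjoint := by
    simp [basisProj, IsSelfAdjoint, star_sum, ContinuousLinearMap.star_eq_adjoint]

theorem norm_basisProj_le (s : Finset ι) : ‖basisProj b s‖ ≤ 1 :=
  (isStarProjection_basisProj b s).norm_le

/-- The compressions of an operator to the spans of finite sets of basis vectors converge. -/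
theorem tendsto_normal_basisProj {n : ℕ} (hn : IsNormalOn Φ n) {w : FreeMonoid (Fin g)}
    (hw : w.length ≤ n) (T : H →L[ℂ] H) :
    Tendsto (fun s => Φ (single w (basisProj b s * T * basisProj b s))) atTop
      (𝓝 (Φ (single w T))) := by
  refine hn w hw atTop _ T (1 * ‖T‖ * 1) (Eventually.of_forall fun s => ?_) fun x y => ?_
  · refine (norm_mul_le _ _).trans ?_
    gcongr
    · refine (norm_mul_le _ _).trans ?_
      gcongr
      exact norm_basisProj_le b s
    · exact norm_basisProj_le b s
  · have h : ∀ s, (inner ℂ y ((basisProj b s * T * basisProj b s) x) : ℂ)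
        = inner ℂ (basisProj b s y) (T (basisProj b s x)) := fun s => by
      have h1 := (isStarProjection_basisProj b s).isSelfAdjoint.star_eq
      rw [ContinuousLinearMap.star_eq_adjoint] at h1
      rw [← ContinuousLinearMap.adjoint_inner_right, h1]
      rfl
    simp only [h]
    exact (tendsto_basisProj b y).inner ((T.continuous.tendsto x).comp (tendsto_basisProj b x))

/-- The finite partial sums of the cyclic vector. -/
def cyclicSum (e : H) (ρ : NCPoly H g →ₗ[ℂ] E) (s : Finset ι) : HilbertTensor H E :=
  ∑ i ∈ s, tmul (b i) (ρ (single 1 (rankOne ℂ e (b i))))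

/-- The Gram kernel supplies `Φ` at `(b i)(b j)*` with weight `⟪Q (b i), P (b j)⟫`, and these terms
add up to the compression of `Q* P`. -/
theorem inner_opTensor_cyclicSum (he : ‖e‖ = 1)
    (hρ : ∀ p ∈ rowPoly e g d, ∀ q ∈ polyLE H g (d + 1), inner ℂ (ρ p) (ρ q) = Φ (adj p * q))
    {Y : Fin g → (E →L[ℂ] E)}
    (hY : ∀ l, ∀ q ∈ rowPoly e g d, Y l (ρ q) = ρ (varPoly H l * q)) (s : Finset ι)
    {v w : FreeMonoid (Fin g)} (hv : v.length ≤ d) (hw : w.length ≤ d + 1) (Q P : H →L[ℂ] H) :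
    inner ℂ (opTensor Q (FreeMonoid.lift Y v) (cyclicSum b e ρ s))
        (opTensor P (FreeMonoid.lift Y w) (cyclicSum b e ρ s))
      = Φ (single (star v * w) (basisProj b s * (star Q * P) * basisProj b s)) := by
  have hproj : basisProj b s * (star Q * P) * basisProj b s
      = ∑ i ∈ s, ∑ j ∈ s, inner ℂ (Q (b i)) (P (b j)) • rankOne ℂ (b i) (b j) := by
    simp only [basisProj, Finset.sum_mul, Finset.mul_sum]
    rw [Finset.sum_comm]
    refine Finset.sum_congr rfl fun i _ => Finset.sum_congr rfl fun j _ => ?_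
    ext x
    simp [ContinuousLinearMap.star_eq_adjoint, ContinuousLinearMap.adjoint_inner_right,
      smul_smul, mul_comm]
  have hsum : ∀ (t : Finset ι) (f : ι → (H →L[ℂ] H)) (u : FreeMonoid (Fin g)),
      Φ (single u (∑ i ∈ t, f i)) = ∑ i ∈ t, Φ (single u (f i)) := fun t f u => by
    rw [← map_sum]
    congr 1
    exact map_sum (MonoidAlgebra.singleAddHom u) f t
  rw [hproj, hsum]
  simp only [hsum, cyclicSum, map_sum, opTensor_tmul, sum_inner]
  refine Finset.sum_congr rfl fun i _ => ?_
  rw [inner_sum]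
  refine Finset.sum_congr rfl fun j _ => ?_
  rw [inner_tmul, lift_apply_row he hY v (hv.trans (Nat.le_succ d)), lift_apply_row he hY w hw,
    inner_row_row he hρ hv hw, ← MonoidAlgebra.smul_single, map_smul, smul_eq_mul]

theorem exists_tendsto_cyclicSum (he : ‖e‖ = 1) (hn : IsNormalOn Φ (2 * d + 2))
    (hρ : ∀ p ∈ rowPoly e g d, ∀ q ∈ polyLE H g (d + 1), inner ℂ (ρ p) (ρ q) = Φ (adj p * q)) :
    ∃ γ : HilbertTensor H E, Tendsto (cyclicSum b e ρ) atTop (𝓝 γ) := by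
  let V : ι → E →ₗᵢ[ℂ] HilbertTensor H E := fun i =>
    { toFun := fun x => tmul (b i) x
      map_add' := fun x y => by
        simp only [tmul, TensorProduct.tmul_add]
        exact UniformSpace.Completion.coe_add _ _
      map_smul' := fun c x => by
        simp only [tmul, TensorProduct.tmul_smul]
        exact UniformSpace.Completion.coe_smul _ _
      norm_map' := fun x => by
        change ‖tmul (b i) x‖ = ‖x‖
        simp [tmul, b.orthonormal.1 i] }
  -- Orthogonality of the copies `b i ⊗ E` reduces convergence to summability of squared norms.
  have hV : OrthogonalFamily ℂ (fun _ : ι => E) V := fun i j hij x y => by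
    change inner ℂ (tmul (b i) x) (tmul (b j) y) = 0
    rw [inner_tmul, b.orthonormal.2 hij, zero_mul]
  have hsq : ∀ i, ‖ρ (single 1 (rankOne ℂ e (b i)))‖ ^ 2
      = (Φ (single 1 (rankOne ℂ (b i) (b i)))).re := fun i => by
    have h := inner_row_row he hρ (v := 1) (w := 1) (by simp) (by simp) (b i) (b i)
    rw [star_one, one_mul] at h
    rw [← h, inner_self_eq_norm_sq_to_K]
    norm_cast
  -- The partial sums are `Φ` at finite basis projections, which converge to the identity.
  have hsum : HasSum (fun i => Φ (single 1 (rankOne ℂ (b i) (b i)))) (Φ (single 1 1)) := by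
    have h := tendsto_normal_basisProj b hn (w := 1) (by simp) 1
    rw [HasSum, SummationFilter.unconditional_filter]
    convert h using 2 with s
    rw [mul_one, (isStarProjection_basisProj b s).isIdempotentElem, ← map_sum]
    congr 1
    exact (map_sum (MonoidAlgebra.singleAddHom (1 : FreeMonoid (Fin g))) _ s).symm
  have hs : Summable fun i => V i (ρ (single 1 (rankOne ℂ e (b i)))) := by
    rw [hV.summable_iff_norm_sq_summable]
    simp only [hsq]
    exact (Complex.hasSum_re hsum).summable
  exact ⟨_, hs.hasSum⟩

end Representation

/-! ### Nontriviality of `K` and passage from monomials to polynomials. -/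

section Conclusion

variable {H : Type u} [NormedAddCommGroup H] [InnerProductSpace ℂ H] [CompleteSpace H] {g d : ℕ}

/-- Over the zero space every self-adjoint tuple satisfies the positivity condition, including the
scalar `N + 1`, which violates the bound. -/
theorem nontrivial_of_domainBounded {K : Type v} [NormedAddCommGroup K] [InnerProductSpace ℂ K]
    (hg : 0 < g) {A : Fin g → (K →L[ℂ] K)} (hbdd : DomainBounded A) : Nontrivial K := by
  by_contra hK
  rw [not_nontrivial_iff_subsingleton] at hK
  obtain ⟨N, hN⟩ := hbdd
  have h := hN 1 (fun _ => ((N + 1 : ℕ) : ℂ) • 1) ⟨fun j => ?_, ?_⟩ ⟨0, hg⟩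
  · rw [map_smul, map_one, norm_smul, norm_one, mul_one, Complex.norm_natCast] at h
    push_cast at h
    linarith
  · rw [Matrix.IsHermitian, Matrix.conjTranspose_smul, Matrix.conjTranspose_one, star_natCast]
  · refine isPositive_eval_pencil_of_dense A _ dense_univ fun n k x _ => ?_
    simp [Subsingleton.elim (k _) 0]

/-- Cut the word after its first `d` letters; `v` is the reversed prefix. -/
theorem exists_eq_star_mul {w : FreeMonoid (Fin g)} (hw : w.length ≤ 2 * d + 1) :
    ∃ v u : FreeMonoid (Fin g), v.length ≤ d ∧ u.length ≤ d + 1 ∧ w = star v * u := by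
  refine ⟨star (FreeMonoid.ofList (w.toList.take d)), FreeMonoid.ofList (w.toList.drop d),
    ?_, ?_, ?_⟩
  · rw [length_star]
    exact List.length_take_le d _
  · change (w.toList.drop d).length ≤ d + 1
    have : w.toList.length ≤ 2 * d + 1 := hw
    rw [List.length_drop]
    omega
  · rw [star_star]
    exact (List.take_append_drop d w.toList).symm

theorem star_lift {E : Type v} [NormedAddCommGroup E] [InnerProductSpace ℂ E] [CompleteSpace E]
    {Y : Fin g → (E →L[ℂ] E)} (hY : ∀ l, IsSelfAdjoint (Y l)) (w : FreeMonoid (Fin g)) :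
    star (FreeMonoid.lift Y w) = FreeMonoid.lift Y (star w) := by
  induction w using FreeMonoid.inductionOn' with
  | one => simp
  | of_mul l w ih =>
    rw [map_mul, star_mul, star_mul, map_mul, ih, FreeMonoid.star_of, FreeMonoid.lift_eval_of,
      (hY l).star_eq]

variable {E : Type v} [NormedAddCommGroup E] [InnerProductSpace ℂ E]
  {Φ : NCPoly H g →ₗ[ℂ] ℂ} {Y : Fin g → (E →L[ℂ] E)} {γ : HilbertTensor H E}

/-- A vector representation on monomials extends to polynomials. -/
theorem eq_inner_eval_of_monomial
    (h : ∀ v w : FreeMonoid (Fin g), v.length ≤ d → w.length ≤ d + 1 → ∀ Q P : H →L[ℂ] H,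
      Φ (single (star v * w) (star Q * P))
        = inner ℂ (opTensor Q (FreeMonoid.lift Y v) γ) (opTensor P (FreeMonoid.lift Y w) γ))
    {q r : NCPoly H g} (hr : r ∈ polyLE H g (d + 1)) (hq : q ∈ polyLE H g d) :
    Φ (adj q * r) = inner ℂ (eval q Y γ) (eval r Y γ) := by
  refine polyLE_induction (motive := fun q => Φ (adj q * r) = inner ℂ (eval q Y γ) (eval r Y γ))
    (by simp) (fun p _ q _ hp hq => ?_) (fun v hv Q => ?_) hq
  · rw [adj_add, add_mul, map_add, hp, hq, eval_add, add_apply, inner_add_left]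
  refine polyLE_induction (motive := fun r => Φ (adj (single v Q) * r)
    = inner ℂ (eval (single v Q) Y γ) (eval r Y γ))
    (by simp) (fun p _ q _ hp hq => ?_) (fun w hw P => ?_) hr
  · rw [mul_add, map_add, hp, hq, eval_add, add_apply, inner_add_right]
  · rw [adj_single, MonoidAlgebra.single_mul_single, h v w hv hw, eval_single, eval_single]

/-- Each monomial splits as an adjoint of degree at most `d` times a factor of degree at most `d +
1`; self-adjointness of `Y` moves the adjoint factor back across the inner product. -/
theorem eq_inner_eval_of_adj_mul [CompleteSpace E] (hY : ∀ l, IsSelfAdjoint (Y l))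
    (h : ∀ {q r : NCPoly H g}, r ∈ polyLE H g (d + 1) → q ∈ polyLE H g d →
      Φ (adj q * r) = inner ℂ (eval q Y γ) (eval r Y γ))
    {p : NCPoly H g} (hp : p ∈ polyLE H g (2 * d + 1)) : Φ p = inner ℂ γ (eval p Y γ) := by
  refine polyLE_induction (motive := fun p => Φ p = inner ℂ γ (eval p Y γ))
    (by simp) (fun p _ q _ hp hq => ?_) (fun w hw P => ?_) hp
  · rw [map_add, hp, hq, eval_add, add_apply, inner_add_right]
  · obtain ⟨v, u, hv, hu, rfl⟩ := exists_eq_star_mul hw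
    have hadj : (single (star v * u) P : NCPoly H g) = adj (single v 1) * single u P := by
      rw [adj_single, MonoidAlgebra.single_mul_single, star_one, one_mul]
    rw [hadj, h (single_mem_polyLE hu P) (single_mem_polyLE hv 1), ← hadj, eval_single,
      eval_single, eval_single, inner_opTensor_left, star_one, star_lift hY, map_mul]
    congr 1
    rw [← one_mul P, opTensor_mul, one_mul]
    rfl

end Conclusion

end NCGNS

end

theorem mainTheorem6
    {H : Type u} [NormedAddCommGroup H] [InnerProductSpace ℂ H] [CompleteSpace H]
    [TopologicalSpace.SeparableSpace H] (hH : ¬ FiniteDimensional ℂ H)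
    {K : Type v} [NormedAddCommGroup K] [InnerProductSpace ℂ K] [CompleteSpace K]
    (g : ℕ) (hg : 0 < g) (d : ℕ)
    (A : Fin g → (K →L[ℂ] K)) (hA : ∀ j, IsSelfAdjoint (A j))
    (hbdd : NCGNS.DomainBounded A)
    (φ : NCGNS.polyLE H g (2 * d + 2) →ₗ[ℂ] ℂ)
    (hφ : Continuous[NCGNS.productUltraweak H g (2 * d + 2), inferInstance] φ)
    (hpos : ∀ p : NCGNS.polyLE H g (2 * d + 2),
      (p : NCGNS.NCPoly H g) ∈ NCGNS.weightedCone H A d → 0 ≤ φ p) :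
    ∃ (E : Type u) (_ : NormedAddCommGroup E) (_ : InnerProductSpace ℂ E)
      (_ : CompleteSpace E) (_ : TopologicalSpace.SeparableSpace E)
      (Y : Fin g → (E →L[ℂ] E)) (γ : NCGNS.HilbertTensor H E),
      (∀ j, IsSelfAdjoint (Y j)) ∧
      (NCGNS.eval (NCGNS.pencil A) Y).IsPositive ∧
      (∀ (r q : NCGNS.NCPoly H g) (hr : r ∈ NCGNS.polyLE H g (d + 1))
        (hq : q ∈ NCGNS.polyLE H g d),
        φ ⟨NCGNS.adj q * r, NCGNS.adj_mul_mem hq hr⟩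
          = inner ℂ (NCGNS.eval q Y γ) (NCGNS.eval r Y γ)) ∧
      (∀ (p : NCGNS.NCPoly H g) (hp : p ∈ NCGNS.polyLE H g (2 * d + 1)),
        φ ⟨p, NCGNS.polyLE_mono (by omega) hp⟩ = inner ℂ γ (NCGNS.eval p Y γ)) := by
  have hK := NCGNS.nontrivial_of_domainBounded hg hbdd
  have hH' : Nontrivial H := by
    by_contra h
    rw [not_nontrivial_iff_subsingleton] at h
    exact hH inferInstance
  obtain ⟨e, he⟩ := exists_norm_eq H zero_le_one
  obtain ⟨ι, b, -⟩ := exists_hilbertBasis ℂ H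
  obtain ⟨Φ, hΦφ⟩ := LinearMap.exists_extend φ
  have hΦ : ∀ p : NCGNS.polyLE H g (2 * d + 2), Φ p = φ p := fun p =>
    congrArg (fun T : NCGNS.polyLE H g (2 * d + 2) →ₗ[ℂ] ℂ => T p) hΦφ
  have hn := NCGNS.isNormalOn_of_continuous hφ hΦ
  have hcone : ∀ p ∈ NCGNS.weightedCone H A d, 0 ≤ Φ p := fun p hp => by
    rw [hΦ ⟨p, NCGNS.weightedCone_subset A d hp⟩]
    exact hpos _ hp
  have hsq : ∀ r ∈ NCGNS.polyLE H g (d + 1), 0 ≤ Φ (NCGNS.adj r * r) := fun r hr =>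
    NCGNS.adj_mul_self_nonneg hH hcone hr
  obtain ⟨E, _, _, _, ρ, hρ, hd⟩ := NCGNS.exists_rowSpace hsq e
  obtain ⟨N, hN, hbound⟩ := NCGNS.exists_var_form_bound hH hbdd hcone (e := e)
  obtain ⟨Y, hYsa, hY⟩ := NCGNS.exists_varOp hsq hρ hd hN hbound
  obtain ⟨γ, hγ⟩ := NCGNS.exists_tendsto_cyclicSum b he hn hρ
  have hmono : ∀ {q r : NCGNS.NCPoly H g}, r ∈ NCGNS.polyLE H g (d + 1) → q ∈ NCGNS.polyLE H g d →
      Φ (NCGNS.adj q * r) = inner ℂ (NCGNS.eval q Y γ) (NCGNS.eval r Y γ) :=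
    NCGNS.eq_inner_eval_of_monomial fun v w hv hw Q P => by
      have hlen : (star v * w).length ≤ 2 * d + 2 := by
        rw [FreeMonoid.length_mul, NCGNS.length_star]
        omega
      -- Both sides are limits of the same net over finite sets of basis vectors: one by normality
      -- of `Φ`, the other by convergence to `γ`.
      refine tendsto_nhds_unique (NCGNS.tendsto_normal_basisProj b hn hlen (star Q * P)) ?_
      simp only [← NCGNS.inner_opTensor_cyclicSum b he hρ hY _ hv hw Q P]
      exact (((NCGNS.opTensor Q _).continuous.tendsto γ).comp hγ).inner
        (((NCGNS.opTensor P _).continuous.tendsto γ).comp hγ)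
  refine ⟨E, inferInstance, inferInstance, inferInstance,
    NCGNS.separableSpace_of_row he hn hρ hd, Y, γ, hYsa,
    NCGNS.isPositive_eval_pencil_of_row hH hcone hρ hd hY, fun r q hr hq => ?_, fun p hp => ?_⟩
  · rw [← hΦ]
    exact hmono hr hq
  · rw [← hΦ]
    exact NCGNS.eq_inner_eval_of_adj_mul hYsa hmono hp
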